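/- Let $G$ be a (real, finite-dimensional) Lie group with Lie algebra $\mathfrak g=T_eG$, let $M$ be a smooth manifold and let $\pi:P\to M$ be a smooth $G$-principal fibre bundle: $P$ is a smooth manifold with a smooth right action of $G$, $\pi$ is a smooth surjection, and every point of $M$ has an open neighbourhood $U$ with a diffeomorphism $\phi:\pi^{-1}(U)\to U\times G$ that commutes with the projections to $U$ and with the right actions of $G$. For $g\in G$ let $\mathfrak{ad}_g:\mathfrak g\to\mathfrak g$ be the differential at $e$ of $h\mapsto ghg^{-1}$ and $R_g:P\to P$, $p\mapsto pg$; let $\theta$ be the Maurer–Cartan form of $G$, $\theta_g=d(L_{g^{-1}})_g:T_gG\to\mathfrak g$; for $A\in\mathfrak g$ let $A^*$ be the fundamental vector field on $P$, where $A^*_p$ is the image of $A$ under the differential at $e$ of $g\mapsto pg$. A local section on an open set $U\subseteq M$ is a smooth map $\sigma_U:U\to P$ with $\pi\circ\sigma_U=\mathrm{id}_U$. A *local connection* on $P$ is a family consisting of a smooth $\mathfrak g$-valued $1$-form $\omega_U$ on $U$ for each local section $\sigma_U:U\to P$ such that, for any two local sections $\sigma_U,\sigma_V$ with $\sigma_V=\sigma_U\,g_{UV}$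 on $U\cap V$, where $g_{UV}:U\cap V\to G$ is smooth, $$\omega_V=g_{UV}^*\theta+\mathfrak{ad}_{g_{UV}^{-1}}\,\omega_U\quad\text{on }U\cap V. \tag{1}$$ A *principal connection form* on $P$ is a smooth $\mathfrak g$-valued $1$-form $\omega$ on $P$ such that $\omega(A^*)=A$ for all $A\in\mathfrak g$ and $R_g^*\omega=\mathfrak{ad}_{g^{-1}}\,\omega$ for all $g\in G$. These two notions are equivalent: 1. For every local connection $(\omega_U)$ there is exactly one principal connection form $\omega$ on $P$ with $\omega_U=\sigma_U^*\omega$ for every local section $\sigma_U$. 2. Conversely, for every principal connection form $\omega$ on $P$, the forms $\omega_U=\sigma_U^*\omega$ are a local connection. 3. The gluing in 1 needs only sections that cover $M$: if $(\sigma_i:U_i\to P)_{i\in I}$ is a family of local sections with $\bigcup_iU_i=M$ and $(\omega_i)_{i\in I}$ are smooth $\mathfrak g$-valued $1$-forms on the $U_i$ that satisfy (1) for all pairs $i,j\in I$, then there is exactly one principal connection form $\omega$ on $P$ with $\omega_i=\sigma_i^*\omega$ for all $i\in I$. -/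

import Mathlib

open scoped Manifold ContDiff RightActions

noncomputable section

namespace PrincipalConn

section Forms

variable {EG : Type*} [NormedAddCommGroup EG] [NormedSpace ℝ EG]
  {HG : Type*} [TopologicalSpace HG] (IG : ModelWithCorners ℝ EG HG)
  (G : Type*) [TopologicalSpace G] [ChartedSpace HG G] [Group G]
  {EN : Type*} [NormedAddCommGroup EN] [NormedSpace ℝ EN]
  {HN : Type*} [TopologicalSpace HN] (IN : ModelWithCorners ℝ EN HN)
  (N : Type*) [TopologicalSpace N] [ChartedSpace HN N]

/-- A (not necessarily smooth) `1`-form on the manifold `N` with values in the Lie algebra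
`𝔤 = T₁G` of `G`: a linear map `T_xN → 𝔤` for each `x`. -/
abbrev LieForm : Type _ := ∀ x : N, TangentSpace IN x →L[ℝ] GroupLieAlgebra IG G

variable {IG G IN N}

/-- A `𝔤`-valued `1`-form is smooth on the set `U` if it is a smooth section over `U` of the vector
bundle `Hom(TN, N × 𝔤)`. (In Mathlib the vector space underlying `𝔤 = T₁G` is the model space
`EG` of `G`, which provides the norm.) -/
def LieForm.SmoothOn [IsManifold IN ∞ N] (α : LieForm IG G IN N) (U : Set N) : Prop :=
  ContMDiffOn IN (IN.prod 𝓘(ℝ, EN →L[ℝ] EG)) ∞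
    (fun x ↦ (Bundle.TotalSpace.mk' (EN →L[ℝ] EG) x (α x) :
      Bundle.TotalSpace (EN →L[ℝ] EG)
        (fun x : N ↦ TangentSpace IN x →L[ℝ] Bundle.Trivial N EG x))) U

end Forms

section Group

variable {EG : Type*} [NormedAddCommGroup EG] [NormedSpace ℝ EG]
  {HG : Type*} [TopologicalSpace HG] (IG : ModelWithCorners ℝ EG HG)
  {G : Type*} [TopologicalSpace G] [ChartedSpace HG G] [Group G]

/-- The Maurer–Cartan form of `G`: `θ_g = d(L_{g⁻¹})_g : T_gG → T_{g⁻¹g}G = 𝔤`. -/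
def maurerCartan : LieForm IG G IG G := fun g ↦
  (mfderiv IG IG (fun h : G ↦ g⁻¹ * h) g : TangentSpace IG g →L[ℝ] TangentSpace IG (g⁻¹ * g))

/-- The adjoint action `𝔞𝔡_g : 𝔤 → 𝔤`, the differential at `1` of `h ↦ g h g⁻¹`. -/
def ad (g : G) : GroupLieAlgebra IG G →L[ℝ] GroupLieAlgebra IG G :=
  (mfderiv IG IG (fun h : G ↦ g * h * g⁻¹) 1 :
    TangentSpace IG (1 : G) →L[ℝ] TangentSpace IG (g * 1 * g⁻¹))

end Group

section Bundle

variable {EG : Type*} [NormedAddCommGroup EG] [NormedSpace ℝ EG]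
  {HG : Type*} [TopologicalSpace HG] (IG : ModelWithCorners ℝ EG HG)
  {G : Type*} [TopologicalSpace G] [ChartedSpace HG G] [Group G]
  {EM : Type*} [NormedAddCommGroup EM] [NormedSpace ℝ EM]
  {HM : Type*} [TopologicalSpace HM] (IM : ModelWithCorners ℝ EM HM)
  {M : Type*} [TopologicalSpace M] [ChartedSpace HM M]
  {EP : Type*} [NormedAddCommGroup EP] [NormedSpace ℝ EP]
  {HP : Type*} [TopologicalSpace HP] (IP : ModelWithCorners ℝ EP HP)
  {P : Type*} [TopologicalSpace P] [ChartedSpace HP P] [MulAction Gᵐᵒᵖ P]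

/-- A bundle chart `(φ, U)`: a diffeomorphism `φ : π⁻¹(U) → U × G`, with `U ⊆ M` open, which
commutes with the projections to `U` and with the right actions of `G`. Here `U = φ.baseSet`, and
compatibility with the projections is part of `Bundle.Trivialization`. -/
structure IsBundleChart {π : P → M} (φ : Bundle.Trivialization G π) : Prop where
  smooth : ContMDiffOn IP (IM.prod IG) ∞ φ φ.source
  smooth_symm : ContMDiffOn (IM.prod IG) IP ∞ φ.toOpenPartialHomeomorph.symm φ.target
  mem_source : ∀ p ∈ φ.source, ∀ g : G, p <• g ∈ φ.source
  equivariant : ∀ p ∈ φ.source, ∀ g : G, φ (p <• g) = ((φ p).1, (φ p).2 * g)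

variable (G) in
/-- `π : P → M`, together with the given right action of `G` on `P` (that is, the given action of
`Gᵐᵒᵖ`, with `p <• g = p · g`), is a smooth `G`-principal fibre bundle. -/
structure IsPrincipalBundle (π : P → M) : Prop where
  smooth_proj : ContMDiff IP IM ∞ π
  surjective_proj : Function.Surjective π
  smooth_action : ContMDiff (IP.prod IG) IP ∞ (fun q : P × G ↦ q.1 <• q.2)
  exists_chart : ∀ x : M, ∃ φ : Bundle.Trivialization G π,
    x ∈ φ.baseSet ∧ IsBundleChart IG IM IP φ

/-- A smooth local section `σ : U → P` of `π` on the open set `U = dom`. The values of `toFun`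
outside `U` are irrelevant. -/
structure LocalSection (π : P → M) where
  dom : Set M
  isOpen_dom : IsOpen dom
  toFun : M → P
  smooth : ContMDiffOn IM IP ∞ toFun dom
  proj : ∀ x ∈ dom, π (toFun x) = x

/-- The pullback `σ^*α` of a `𝔤`-valued form on `P` along a local section; it is meaningful at the
points of `σ.dom`. -/
def LocalSection.pullback {IM : ModelWithCorners ℝ EM HM} {IP : ModelWithCorners ℝ EP HP}
    {IG : ModelWithCorners ℝ EG HG} {π : P → M}
    (σ : LocalSection IM IP π) (α : LieForm IG G IP P) : LieForm IG G IM M :=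
  fun x ↦ (α (σ.toFun x)).comp (mfderiv IM IP σ.toFun x)

/-- Given a family of local sections `σ i` on `U i`, a compatible family of local connection forms:
smooth `𝔤`-valued forms `α i` on `U i` such that, whenever `σ j = σ i · g` on `U i ∩ U j` for a
smooth `G`-valued function `g`, one has `α j = g^*θ + 𝔞𝔡_{g⁻¹} (α i)` on `U i ∩ U j`.
The values of `α i` outside `U i` are irrelevant. -/
structure IsCompatibleFamily [IsManifold IM ∞ M] {π : P → M} {ι : Type*}
    (σ : ι → LocalSection IM IP π) (α : ι → LieForm IG G IM M) : Prop where
  smooth : ∀ i, (α i).SmoothOn (σ i).dom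
  transition : ∀ (i j : ι) (g : M → G),
    ContMDiffOn IM IG ∞ g ((σ i).dom ∩ (σ j).dom) →
    (∀ x ∈ (σ i).dom ∩ (σ j).dom, (σ j).toFun x = (σ i).toFun x <• g x) →
    ∀ x ∈ (σ i).dom ∩ (σ j).dom,
      α j x = (maurerCartan IG (g x)).comp (mfderiv IM IG g x) + (ad IG (g x)⁻¹).comp (α i x)

/-- A connection given locally: a compatible family of local connection forms indexed by all the
local sections of `P`. -/
def IsLocalConnection [IsManifold IM ∞ M] {π : P → M}
    (α : LocalSection IM IP π → LieForm IG G IM M) : Prop :=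
  IsCompatibleFamily IG IM IP (fun σ : LocalSection IM IP π ↦ σ) α

/-- The fundamental vector field `A^*` of `A ∈ 𝔤`: `A^*_p ∈ T_{p·1}P = T_pP` is the image of `A`
under the differential at `1` of `g ↦ p · g`. -/
def fundamentalField (A : GroupLieAlgebra IG G) (p : P) : TangentSpace IP p :=
  (mfderiv IG IP (fun g : G ↦ p <• g) 1 :
    TangentSpace IG (1 : G) →L[ℝ] TangentSpace IP (p <• (1 : G))) A

/-- A principal connection form on `P`: a smooth `𝔤`-valued form `α` with `α(A^*) = A` for all
`A ∈ 𝔤` and `R_g^*α = 𝔞𝔡_{g⁻¹} α` for all `g ∈ G`, where `R_g(p) = p · g`. -/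
structure IsPrincipalConnection [IsManifold IP ∞ P] (α : LieForm IG G IP P) : Prop where
  smooth : α.SmoothOn Set.univ
  fundamental : ∀ (A : GroupLieAlgebra IG G) (p : P), α p (fundamentalField IG IP A p) = A
  equivariant : ∀ (g : G) (p : P),
    (α (p <• g)).comp (mfderiv IP IP (fun q : P ↦ q <• g) p) = (ad IG g⁻¹).comp (α p)

end Bundle

end PrincipalConn

end

/-!
For a `𝔤`-valued form `α` and a `G`-valued function `g` on the same manifold put
`α^g = g^*θ + 𝔞𝔡_{g⁻¹} α`. The product rule `(fg)^*θ = 𝔞𝔡_{g⁻¹} (f^*θ) + g^*θ` for the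
Maurer–Cartan form makes this a right action, `(α^g)^h = α^{gh}`, and it is natural under pullback.
In these terms the two conditions on a principal connection form `α` say that
`(f · g)^*α = (f^*α)^g` for all maps `f` into `P` and `g` into `G`, and the transition rule for a
local connection is `β_j = (β_i)^g` when `σ_j = σ_i · g`.

Over the domain of a local section `σ`, every point of `P` is `p = σ(π p) · c(p)`. Hence a
principal connection form with `σ^*α = β` must be `(π^*β)^c`, which gives uniqueness, and this
formula does define one. If `τ = σ · g`, then `c_σ = (g ∘ π) c_τ`, so
`(π^*β)^{c_σ} = ((π^*β)^{g ∘ π})^{c_τ} = (π^*(β^g))^{c_τ}`: the forms obtained from `σ` and `τ`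
agree exactly because of the transition rule, and the local forms glue.
-/

noncomputable section

open scoped Topology

namespace PrincipalConn

section TangentCoordinates

variable {𝕜 : Type*} [NontriviallyNormedField 𝕜]
  {E₁ : Type*} [NormedAddCommGroup E₁] [NormedSpace 𝕜 E₁]
  {H₁ : Type*} [TopologicalSpace H₁] {I₁ : ModelWithCorners 𝕜 E₁ H₁}
  {M₁ : Type*} [TopologicalSpace M₁] [ChartedSpace H₁ M₁] [IsManifold I₁ 1 M₁]
  {E₂ : Type*} [NormedAddCommGroup E₂] [NormedSpace 𝕜 E₂]
  {H₂ : Type*} [TopologicalSpace H₂] {I₂ : ModelWithCorners 𝕜 E₂ H₂}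
  {M₂ : Type*} [TopologicalSpace M₂] [ChartedSpace H₂ M₂] [IsManifold I₂ 1 M₂]
  {E₃ : Type*} [NormedAddCommGroup E₃] [NormedSpace 𝕜 E₃]
  {H₃ : Type*} [TopologicalSpace H₃] {I₃ : ModelWithCorners 𝕜 E₃ H₃}
  {M₃ : Type*} [TopologicalSpace M₃] [ChartedSpace H₃ M₃] [IsManifold I₃ 1 M₃]
  {X : Type*}

theorem inTangentCoordinates_comp {f₁ : X → M₁} {f₂ : X → M₂} {f₃ : X → M₃}
    (ψ : X → E₂ →L[𝕜] E₃) (φ : X → E₁ →L[𝕜] E₂) {x₀ x : X}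
    (hx : f₂ x ∈ (chartAt H₂ (f₂ x₀)).source) :
    inTangentCoordinates I₁ I₃ f₁ f₃ (fun y ↦ (ψ y).comp (φ y)) x₀ x =
      (inTangentCoordinates I₂ I₃ f₂ f₃ ψ x₀ x).comp
        (inTangentCoordinates I₁ I₂ f₁ f₂ φ x₀ x) := by
  ext v
  exact congrArg
    (fun w : E₂ ↦ (trivializationAt E₃ (TangentSpace I₃ : M₃ → Type _)
      (f₃ x₀)).continuousLinearMapAt 𝕜 (f₃ x) (ψ x w))
    ((trivializationAt E₂ (TangentSpace I₂ : M₂ → Type _)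
      (f₂ x₀)).symmL_continuousLinearMapAt (R := 𝕜) (b := f₂ x) (by simpa using hx) _).symm

theorem inTangentCoordinates_const (a : M₁) (b : M₂) (φ : X → E₁ →L[𝕜] E₂) (x₀ : X) :
    inTangentCoordinates I₁ I₂ (fun _ ↦ a) (fun _ ↦ b) φ x₀ = φ := by
  funext x
  rw [inTangentCoordinates_eq (fun _ ↦ a) (fun _ ↦ b) φ (mem_chart_source _ _)
    (mem_chart_source _ _)]
  ext v
  simp only [ContinuousLinearMap.comp_apply]
  rw [(tangentBundleCore I₁ M₁).coordChange_self _ _ (mem_chart_source _ _),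
    (tangentBundleCore I₂ M₂).coordChange_self _ _ (mem_chart_source _ _)]

end TangentCoordinates

section LieForm

variable {EG : Type*} [NormedAddCommGroup EG] [NormedSpace ℝ EG]
  {HG : Type*} [TopologicalSpace HG] {IG : ModelWithCorners ℝ EG HG}
  {G : Type*} [TopologicalSpace G] [ChartedSpace HG G] [Group G]
  {EN : Type*} [NormedAddCommGroup EN] [NormedSpace ℝ EN]
  {HN : Type*} [TopologicalSpace HN] {IN : ModelWithCorners ℝ EN HN}
  {N : Type*} [TopologicalSpace N] [ChartedSpace HN N]
  {EQ : Type*} [NormedAddCommGroup EQ] [NormedSpace ℝ EQ]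
  {HQ : Type*} [TopologicalSpace HQ] {IQ : ModelWithCorners ℝ EQ HQ}
  {Q : Type*} [TopologicalSpace Q] [ChartedSpace HQ Q]
  {ER : Type*} [NormedAddCommGroup ER] [NormedSpace ℝ ER]
  {HR : Type*} [TopologicalSpace HR] {IR : ModelWithCorners ℝ ER HR}
  {R : Type*} [TopologicalSpace R] [ChartedSpace HR R]

namespace LieForm

variable (IN) in
/-- The pullback `f^*α` of a `𝔤`-valued form along a map of manifolds. It is meaningful at the
points where `f` is differentiable. -/
def pullback (f : N → Q) (α : LieForm IG G IQ Q) : LieForm IG G IN N :=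
  fun x ↦ (α (f x)).comp (mfderiv IN IQ f x)

theorem pullback_congr {f f' : N → Q} {α α' : LieForm IG G IQ Q} {x : N}
    (hf : f =ᶠ[𝓝 x] f') (hα : α (f x) = α' (f x)) :
    α.pullback IN f x = α'.pullback IN f' x := by
  let αx : Q → EQ →L[ℝ] EG := α'
  have hx : αx (f x) = αx (f' x) := congrArg αx hf.eq_of_nhds
  have hd : (mfderiv IN IQ f x : EN →L[ℝ] EQ) = mfderiv IN IQ f' x := hf.mfderiv_eq
  rw [pullback, hα]
  exact congrArg₂ ContinuousLinearMap.comp hx hd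

theorem pullback_comp {g : Q → R} {f : N → Q} {x : N} (α : LieForm IG G IR R)
    (hg : MDifferentiableAt IQ IR g (f x)) (hf : MDifferentiableAt IN IQ f x) :
    α.pullback IN (fun y ↦ g (f y)) x = (α.pullback IQ g).pullback IN f x :=
  congrArg (α (g (f x))).comp (mfderiv_comp x hg hf)

theorem pullback_id (α : LieForm IG G IN N) (x : N) : α.pullback IN (fun y ↦ y) x = α x :=
  congrArg (α x).comp mfderiv_id

theorem pullback_const (α : LieForm IG G IQ Q) (q : Q) (x : N) :
    α.pullback IN (fun _ ↦ q) x = 0 :=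
  (congrArg (α q).comp mfderiv_const).trans (α q).comp_zero

theorem pullback_prodMk {F : N × Q → R} {ES : Type*} [NormedAddCommGroup ES] [NormedSpace ℝ ES]
    {HS : Type*} [TopologicalSpace HS] {IS : ModelWithCorners ℝ ES HS}
    {S : Type*} [TopologicalSpace S] [ChartedSpace HS S] {f : S → N} {g : S → Q} {x : S}
    (α : LieForm IG G IR R) (hF : MDifferentiableAt (IN.prod IQ) IR F (f x, g x))
    (hf : MDifferentiableAt IS IN f x) (hg : MDifferentiableAt IS IQ g x) :
    α.pullback IS (fun y ↦ F (f y, g y)) x =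
      (α.pullback IN fun z ↦ F (z, g x)).pullback IS f x +
        (α.pullback IQ fun z ↦ F (f x, z)).pullback IS g x := by
  rw [α.pullback_comp (g := F) (f := fun y ↦ (f y, g y)) hF (hf.prodMk hg)]
  ext v
  simp only [pullback, hf.mfderiv_prod hg]
  exact (congrArg (α (F (f x, g x))) (mfderiv_prod_eq_add_apply hF)).trans (map_add _ _ _)

/-- Smoothness at a point of a `𝔤`-valued form, with `TN` and `𝔤 = T₁G` both read in tangent
coordinates. Keeping `𝔤` as a tangent space makes the results on smoothness of `mfderiv` apply
verbatim. -/
def SmoothAt [IsManifold IG 1 G] [IsManifold IN ∞ N] (α : LieForm IG G IN N) (x : N) : Prop :=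
  ContMDiffAt IN 𝓘(ℝ, EN →L[ℝ] EG) ∞ (inTangentCoordinates IN IG id (fun _ ↦ (1 : G)) α x) x

theorem smoothOn_iff_forall_smoothAt [IsManifold IG 1 G] [IsManifold IN ∞ N]
    {α : LieForm IG G IN N} {U : Set N} (hU : IsOpen U) :
    α.SmoothOn U ↔ ∀ x ∈ U, α.SmoothAt x := by
  have continuousLinearMapAt_one (A : EG) :
      (trivializationAt EG (TangentSpace IG : G → Type _) 1).continuousLinearMapAt ℝ 1 A = A := by
    rw [TangentBundle.continuousLinearMapAt_trivializationAt_eq_core (mem_chart_source _ _)]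
    exact (tangentBundleCore IG G).coordChange_self _ _ (mem_chart_source _ _) A
  have inCoordinates_eq (x y : N) : ContinuousLinearMap.inCoordinates EN (TangentSpace IN) EG
      (Bundle.Trivial N EG) x y x y (α y) =
        inTangentCoordinates IN IG id (fun _ ↦ (1 : G)) α x y := by
    ext v
    simp only [ContinuousLinearMap.inCoordinates, Bundle.Trivial.fiberBundle_trivializationAt',
      Bundle.Trivial.continuousLinearMapAt_trivialization]
    exact (continuousLinearMapAt_one _).symm
  refine ⟨fun h x hx ↦ ?_, fun h x hx ↦ ContMDiffAt.contMDiffWithinAt ?_⟩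
  · have := ((contMDiffAt_hom_bundle _).1 ((h x hx).contMDiffAt (hU.mem_nhds hx))).2
    simpa only [inCoordinates_eq, SmoothAt] using this
  · refine (contMDiffAt_hom_bundle _).2 ⟨contMDiffAt_id, ?_⟩
    simpa only [inCoordinates_eq, SmoothAt] using h x hx

variable [IsManifold IG 1 G] [IsManifold IN ∞ N]

theorem SmoothAt.congr {α β : LieForm IG G IN N} {x : N} (hα : α.SmoothAt x)
    (h : ∀ᶠ y in 𝓝 x, β y = α y) : β.SmoothAt x := by
  refine ContMDiffAt.congr_of_eventuallyEq hα ?_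
  filter_upwards [h] with y hy
  simp only [inTangentCoordinates, hy]

theorem SmoothAt.add {α β : LieForm IG G IN N} {x : N} (hα : α.SmoothAt x) (hβ : β.SmoothAt x) :
    SmoothAt (IG := IG) (G := G) (IN := IN) (fun y ↦ α y + β y) x := by
  refine (ContMDiffAt.add hα hβ).congr_of_eventuallyEq (.of_forall fun y ↦ ?_)
  simp [inTangentCoordinates, ContinuousLinearMap.inCoordinates]

theorem SmoothAt.clm_comp {α : LieForm IG G IN N} {x : N}
    {L : N → EG →L[ℝ] EG} (hL : ContMDiffAt IN 𝓘(ℝ, EG →L[ℝ] EG) ∞ L x) (hα : α.SmoothAt x) :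
    SmoothAt (IG := IG) (G := G) (IN := IN) (fun y ↦ (L y).comp (α y)) x := by
  refine (ContMDiffAt.clm_comp hL hα).congr_of_eventuallyEq (.of_forall fun y ↦ ?_)
  have := inTangentCoordinates_comp (I₁ := IN) (I₂ := IG) (I₃ := IG) (f₁ := id)
    (f₂ := fun _ ↦ (1 : G)) (f₃ := fun _ ↦ (1 : G)) L α (x₀ := x) (x := y) (mem_chart_source _ _)
  rwa [inTangentCoordinates_const] at this

theorem SmoothAt.pullback [IsManifold IQ ∞ Q] {α : LieForm IG G IQ Q} {f : N → Q} {x : N}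
    (hα : α.SmoothAt (f x)) (hf : ContMDiffAt IN IQ ∞ f x) : (α.pullback IN f).SmoothAt x := by
  have hα' : ContMDiffAt IN 𝓘(ℝ, EQ →L[ℝ] EG) ∞
      (inTangentCoordinates IQ IG f (fun _ ↦ (1 : G)) (fun y ↦ α (f y)) x) x :=
    ContMDiffAt.comp (g := inTangentCoordinates IQ IG id (fun _ ↦ (1 : G)) α (f x)) x hα hf
  refine (hα'.clm_comp (ContMDiffAt.mfderiv_const (m := ∞) hf le_rfl)).congr_of_eventuallyEq ?_
  filter_upwards [hf.continuousAt (chart_source_mem_nhds HQ (f x))] with y hy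
  exact inTangentCoordinates_comp (I₁ := IN) (I₂ := IQ) (I₃ := IG) (f₁ := id) (f₂ := f)
    (f₃ := fun _ ↦ (1 : G)) (fun y ↦ α (f y)) (fun y ↦ mfderiv IN IQ f y) hy

end LieForm

end LieForm

section MaurerCartan

variable {EG : Type*} [NormedAddCommGroup EG] [NormedSpace ℝ EG]
  {HG : Type*} [TopologicalSpace HG] {IG : ModelWithCorners ℝ EG HG}
  {G : Type*} [TopologicalSpace G] [ChartedSpace HG G] [Group G]
  {EN : Type*} [NormedAddCommGroup EN] [NormedSpace ℝ EN]
  {HN : Type*} [TopologicalSpace HN] {IN : ModelWithCorners ℝ EN HN}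
  {N : Type*} [TopologicalSpace N] [ChartedSpace HN N]

theorem ad_one : ad IG (1 : G) = ContinuousLinearMap.id ℝ EG := by
  have conj_one : (fun h : G ↦ 1 * h * 1⁻¹) = id := by funext h; simp
  rw [ad, conj_one]
  exact mfderiv_id

theorem maurerCartan_one : maurerCartan IG (1 : G) = ContinuousLinearMap.id ℝ EG := by
  have inv_one_mul : (fun h : G ↦ 1⁻¹ * h) = id := by funext h; simp
  rw [maurerCartan, inv_one_mul]
  exact mfderiv_id

variable [LieGroup IG ∞ G]

theorem mdifferentiable_mul_left (a : G) : MDifferentiable IG IG fun h : G ↦ a * h :=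
  (contMDiff_mul_left (n := ∞) (I := IG)).mdifferentiable (by simp)

theorem mdifferentiable_mul_right (a : G) : MDifferentiable IG IG fun h : G ↦ h * a :=
  (contMDiff_mul_right (n := ∞) (I := IG)).mdifferentiable (by simp)

theorem mdifferentiable_conj (a : G) : MDifferentiable IG IG fun h : G ↦ a * h * a⁻¹ :=
  (mdifferentiable_mul_right a⁻¹).comp (mdifferentiable_mul_left a)

theorem ad_mul (a b : G) : ad IG (a * b) = (ad IG a).comp (ad IG b) := by
  have conj_mul : (fun h : G ↦ a * b * h * (a * b)⁻¹) =
      fun h ↦ a * (b * h * b⁻¹) * a⁻¹ := by funext h; group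
  have conj_one : b * 1 * b⁻¹ = 1 := by group
  rw [ad, conj_mul]
  exact (mfderiv_comp (1 : G) (mdifferentiable_conj a _) (mdifferentiable_conj b _)).trans
    (congrArg (fun L : EG →L[ℝ] EG ↦ L.comp (ad IG b)) (mfderiv_congr_point conj_one))

theorem contMDiff_ad :
    ContMDiff (M' := EG →L[ℝ] EG) IG 𝓘(ℝ, EG →L[ℝ] EG) ∞ fun g : G ↦ ad IG g := by
  intro g
  have h := ContMDiffAt.mfderiv (I := IG) (I' := IG) (m := ∞) (n := ∞)
    (fun (y h : G) ↦ y * h * y⁻¹) (fun _ ↦ (1 : G)) (x₀ := g)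
    ((contMDiffAt_fst.mul contMDiffAt_snd).mul contMDiffAt_fst.inv) contMDiffAt_const le_rfl
  have conj_one : (fun y : G ↦ y * 1 * y⁻¹) = fun _ ↦ 1 := by funext y; group
  rw [conj_one] at h
  exact inTangentCoordinates_const (I₁ := IG) (I₂ := IG) (1 : G) (1 : G) (ad IG) g ▸ h

theorem smoothAt_maurerCartan (g : G) : (maurerCartan IG).SmoothAt g := by
  have h := ContMDiffAt.mfderiv (I := IG) (I' := IG) (m := ∞) (n := ∞)
    (fun (y h : G) ↦ y⁻¹ * h) id (x₀ := g) (contMDiffAt_fst.inv.mul contMDiffAt_snd)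
    contMDiffAt_id le_rfl
  simp only [id_eq, inv_mul_cancel] at h
  exact h

theorem pullback_mul_left_maurerCartan (a x : G) :
    (maurerCartan IG).pullback IG (fun h ↦ a * h) x = maurerCartan IG x := by
  have mul_left_eq : (fun h : G ↦ (a * x)⁻¹ * (a * h)) = fun h ↦ x⁻¹ * h := by funext h; group
  exact (mfderiv_comp x (mdifferentiable_mul_left (a * x)⁻¹ _)
    (mdifferentiable_mul_left a x)).symm.trans (mfderiv_congr mul_left_eq)

theorem pullback_mul_right_maurerCartan (a x : G) :
    (maurerCartan IG).pullback IG (fun h ↦ h * a) x = (ad IG a⁻¹).comp (maurerCartan IG x) := by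
  have mul_right_eq : (fun h : G ↦ (x * a)⁻¹ * (h * a)) =
      fun h ↦ a⁻¹ * (x⁻¹ * h) * a⁻¹⁻¹ := by funext h; group
  have mfderiv_mul_right : (maurerCartan IG).pullback IG (fun h ↦ h * a) x =
      mfderiv IG IG (fun h : G ↦ (x * a)⁻¹ * (h * a)) x :=
    (mfderiv_comp x (mdifferentiable_mul_left (x * a)⁻¹ _) (mdifferentiable_mul_right a x)).symm
  rw [mfderiv_mul_right]
  exact (mfderiv_congr mul_right_eq).trans <|
    (mfderiv_comp x (mdifferentiable_conj a⁻¹ _) (mdifferentiable_mul_left x⁻¹ x)).trans <|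
    congrArg (fun L : EG →L[ℝ] EG ↦ L.comp (maurerCartan IG x))
      (mfderiv_congr_point (inv_mul_cancel x))

theorem pullback_mul_maurerCartan {f g : N → G} {x : N} (hf : MDifferentiableAt IN IG f x)
    (hg : MDifferentiableAt IN IG g x) :
    (maurerCartan IG).pullback IN (fun y ↦ f y * g y) x =
      (ad IG (g x)⁻¹).comp ((maurerCartan IG).pullback IN f x) +
        (maurerCartan IG).pullback IN g x := by
  have mdiff_mul : MDifferentiable (IG.prod IG) IG fun q : G × G ↦ q.1 * q.2 :=
    (contMDiff_mul IG ∞).mdifferentiable (by simp)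
  rw [LieForm.pullback_prodMk _ (F := fun q : G × G ↦ q.1 * q.2) (mdiff_mul _) hf hg]
  refine congrArg₂ (· + ·) ?_ ?_
  · exact congrArg (fun L : EG →L[ℝ] EG ↦ L.comp (mfderiv IN IG f x))
      (pullback_mul_right_maurerCartan (g x) (f x))
  · exact congrArg (fun L : EG →L[ℝ] EG ↦ L.comp (mfderiv IN IG g x))
      (pullback_mul_left_maurerCartan (f x) (g x))

end MaurerCartan

section Gauge

variable {EG : Type*} [NormedAddCommGroup EG] [NormedSpace ℝ EG]
  {HG : Type*} [TopologicalSpace HG] {IG : ModelWithCorners ℝ EG HG}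
  {G : Type*} [TopologicalSpace G] [ChartedSpace HG G] [Group G]
  {EN : Type*} [NormedAddCommGroup EN] [NormedSpace ℝ EN]
  {HN : Type*} [TopologicalSpace HN] {IN : ModelWithCorners ℝ EN HN}
  {N : Type*} [TopologicalSpace N] [ChartedSpace HN N]
  {EQ : Type*} [NormedAddCommGroup EQ] [NormedSpace ℝ EQ]
  {HQ : Type*} [TopologicalSpace HQ] {IQ : ModelWithCorners ℝ EQ HQ}
  {Q : Type*} [TopologicalSpace Q] [ChartedSpace HQ Q]

namespace LieForm

/-- The gauge transform `α^g = g^*θ + 𝔞𝔡_{g⁻¹} α` of a `𝔤`-valued form on `N` by a map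
`g : N → G`. The transition rule for local connection forms reads `α j = (α i)^g`. -/
def gauge (g : N → G) (α : LieForm IG G IN N) : LieForm IG G IN N :=
  fun x ↦ (maurerCartan IG).pullback IN g x + (ad IG (g x)⁻¹).comp (α x)

theorem gauge_congr {g g' : N → G} {α α' : LieForm IG G IN N} {x : N} (hg : g =ᶠ[𝓝 x] g')
    (hα : α x = α' x) : α.gauge g x = α'.gauge g' x := by
  rw [gauge, gauge, pullback_congr (α := maurerCartan IG) hg rfl, hg.eq_of_nhds, hα]

theorem gauge_const (g : G) (α : LieForm IG G IN N) (x : N) :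
    α.gauge (fun _ ↦ g) x = (ad IG g⁻¹).comp (α x) := by
  rw [gauge, pullback_const, zero_add]

theorem gauge_one (α : LieForm IG G IN N) (x : N) : α.gauge (fun _ ↦ (1 : G)) x = α x := by
  rw [gauge_const, inv_one, ad_one]
  exact ContinuousLinearMap.id_comp _

theorem pullback_gauge {g : Q → G} {f : N → Q} {x : N} (α : LieForm IG G IQ Q)
    (hg : MDifferentiableAt IQ IG g (f x)) (hf : MDifferentiableAt IN IQ f x) :
    (α.gauge g).pullback IN f x = (α.pullback IN f).gauge (fun y ↦ g (f y)) x := by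
  rw [gauge, (maurerCartan IG).pullback_comp hg hf]
  exact ContinuousLinearMap.add_comp _ _ _

variable [LieGroup IG ∞ G]

theorem gauge_gauge {g h : N → G} {x : N} (α : LieForm IG G IN N)
    (hg : MDifferentiableAt IN IG g x) (hh : MDifferentiableAt IN IG h x) :
    (α.gauge g).gauge h x = α.gauge (fun y ↦ g y * h y) x := by
  simp only [gauge, pullback_mul_maurerCartan hg hh, mul_inv_rev, ad_mul,
    ContinuousLinearMap.comp_add, ContinuousLinearMap.comp_assoc]
  abel

theorem SmoothAt.gauge [IsManifold IN ∞ N] {g : N → G} {α : LieForm IG G IN N} {x : N}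
    (hα : α.SmoothAt x) (hg : ContMDiffAt IN IG ∞ g x) : (α.gauge g).SmoothAt x :=
  ((smoothAt_maurerCartan (g x)).pullback hg).add <|
    .clm_comp ((contMDiff_ad (g x)⁻¹).comp x hg.inv) hα

end LieForm

end Gauge

section PrincipalConnection

variable {EG : Type*} [NormedAddCommGroup EG] [NormedSpace ℝ EG]
  {HG : Type*} [TopologicalSpace HG] {IG : ModelWithCorners ℝ EG HG}
  {G : Type*} [TopologicalSpace G] [ChartedSpace HG G] [Group G]
  {EP : Type*} [NormedAddCommGroup EP] [NormedSpace ℝ EP]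
  {HP : Type*} [TopologicalSpace HP] {IP : ModelWithCorners ℝ EP HP}
  {P : Type*} [TopologicalSpace P] [ChartedSpace HP P] [MulAction Gᵐᵒᵖ P]
  {EN : Type*} [NormedAddCommGroup EN] [NormedSpace ℝ EN]
  {HN : Type*} [TopologicalSpace HN] {IN : ModelWithCorners ℝ EN HN}
  {N : Type*} [TopologicalSpace N] [ChartedSpace HN N]

theorem LieForm.apply_fundamentalField (α : LieForm IG G IP P) (A : GroupLieAlgebra IG G) (p : P) :
    α p (fundamentalField IG IP A p) = α.pullback IG (fun g : G ↦ p <• g) 1 A := by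
  have smul_one : p <• (1 : G) = p := by simp
  let αm : P → EP →L[ℝ] EG := α
  exact congrArg (fun q ↦ αm q (fundamentalField IG IP A p)) smul_one.symm

namespace IsPrincipalConnection

theorem pullback_orbit_one [IsManifold IP ∞ P] {α : LieForm IG G IP P}
    (hα : IsPrincipalConnection IG IP α) (p : P) :
    α.pullback IG (fun g : G ↦ p <• g) 1 = ContinuousLinearMap.id ℝ EG := by
  ext A
  exact (α.apply_fundamentalField A p).symm.trans (hα.fundamental A p)

variable [LieGroup IG ∞ G] [IsManifold IP ∞ P] {α : LieForm IG G IP P}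

theorem pullback_orbit (hα : IsPrincipalConnection IG IP α)
    (hact : MDifferentiable (IP.prod IG) IP fun q : P × G ↦ q.1 <• q.2) (p : P) (a : G) :
    α.pullback IG (fun g : G ↦ p <• g) a = maurerCartan IG a := by
  have smul_eq : (fun g : G ↦ p <• g) = fun g ↦ (p <• a) <• (a⁻¹ * g) := by
    funext g; simp [smul_smul]
  have smul_mdiff : MDifferentiable IG IP fun g : G ↦ (p <• a) <• g :=
    hact.comp (mdifferentiable_const.prodMk mdifferentiable_id)
  rw [smul_eq, α.pullback_comp (g := fun g : G ↦ (p <• a) <• g) (smul_mdiff _)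
    (mdifferentiable_mul_left a⁻¹ a), LieForm.pullback, inv_mul_cancel, hα.pullback_orbit_one]
  exact ContinuousLinearMap.id_comp _

theorem pullback_smul (hα : IsPrincipalConnection IG IP α)
    (hact : MDifferentiable (IP.prod IG) IP fun q : P × G ↦ q.1 <• q.2)
    {f : N → P} {g : N → G} {x : N} (hf : MDifferentiableAt IN IP f x)
    (hg : MDifferentiableAt IN IG g x) :
    α.pullback IN (fun y ↦ f y <• g y) x = (α.pullback IN f).gauge g x := by
  rw [α.pullback_prodMk (F := fun q : P × G ↦ q.1 <• q.2) (hact _) hf hg, add_comm]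
  refine congrArg₂ (· + ·) ?_ ?_
  · exact congrArg (fun L : EG →L[ℝ] EG ↦ L.comp (mfderiv IN IG g x))
      (hα.pullback_orbit hact (f x) (g x))
  · exact congrArg (fun L : EP →L[ℝ] EG ↦ L.comp (mfderiv IN IP f x))
      (hα.equivariant (g x) (f x))

end IsPrincipalConnection

end PrincipalConnection

section PrincipalBundle

variable {EG : Type*} [NormedAddCommGroup EG] [NormedSpace ℝ EG]
  {HG : Type*} [TopologicalSpace HG] {IG : ModelWithCorners ℝ EG HG}
  {G : Type*} [TopologicalSpace G] [ChartedSpace HG G] [Group G]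
  {EM : Type*} [NormedAddCommGroup EM] [NormedSpace ℝ EM]
  {HM : Type*} [TopologicalSpace HM] {IM : ModelWithCorners ℝ EM HM}
  {M : Type*} [TopologicalSpace M] [ChartedSpace HM M]
  {EP : Type*} [NormedAddCommGroup EP] [NormedSpace ℝ EP]
  {HP : Type*} [TopologicalSpace HP] {IP : ModelWithCorners ℝ EP HP}
  {P : Type*} [TopologicalSpace P] [ChartedSpace HP P] [MulAction Gᵐᵒᵖ P]
  {EN : Type*} [NormedAddCommGroup EN] [NormedSpace ℝ EN]
  {HN : Type*} [TopologicalSpace HN] {IN : ModelWithCorners ℝ EN HN}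
  {N : Type*} [TopologicalSpace N] [ChartedSpace HN N]
  {π : P → M}

variable (G) in
/-- The translation function of a principal bundle: the element `g : G` with `q = p · g`, for `p`
and `q` in the same fibre (an arbitrary element if there is none). -/
def translation (p q : P) : G := Classical.epsilon fun g : G ↦ p <• g = q

namespace IsPrincipalBundle

theorem mdifferentiable_proj (hπ : IsPrincipalBundle IG G IM IP π) : MDifferentiable IP IM π :=
  hπ.smooth_proj.mdifferentiable (by simp)

theorem mdifferentiable_action (hπ : IsPrincipalBundle IG G IM IP π) :
    MDifferentiable (IP.prod IG) IP fun q : P × G ↦ q.1 <• q.2 :=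
  hπ.smooth_action.mdifferentiable (by simp)

theorem proj_smul (hπ : IsPrincipalBundle IG G IM IP π) (p : P) (g : G) :
    π (p <• g) = π p := by
  obtain ⟨φ, hx, hφ⟩ := hπ.exists_chart (π p)
  have hp := φ.mem_source.2 hx
  rw [← φ.coe_fst hp, ← φ.coe_fst (hφ.mem_source p hp g), hφ.equivariant p hp]

theorem exists_smul_eq (hπ : IsPrincipalBundle IG G IM IP π) {p q : P} (h : π p = π q) :
    ∃ g : G, p <• g = q := by
  obtain ⟨φ, hx, hφ⟩ := hπ.exists_chart (π p)
  have hp := φ.mem_source.2 hx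
  have hq := φ.mem_source.2 (h ▸ hx)
  refine ⟨(φ p).2⁻¹ * (φ q).2, φ.injOn (hφ.mem_source p hp _) hq ?_⟩
  change φ _ = φ q
  rw [hφ.equivariant p hp, mul_inv_cancel_left]
  exact Prod.ext (by rw [φ.coe_fst hp, φ.coe_fst hq, h]) rfl

theorem smul_left_cancel (hπ : IsPrincipalBundle IG G IM IP π) {p : P} {g h : G}
    (hgh : p <• g = p <• h) : g = h := by
  obtain ⟨φ, hx, hφ⟩ := hπ.exists_chart (π p)
  have hp := φ.mem_source.2 hx
  have := congrArg φ hgh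
  rw [hφ.equivariant p hp, hφ.equivariant p hp] at this
  exact mul_left_cancel (Prod.ext_iff.1 this).2

theorem smul_translation (hπ : IsPrincipalBundle IG G IM IP π) {p q : P} (h : π p = π q) :
    p <• translation G p q = q :=
  Classical.epsilon_spec (hπ.exists_smul_eq h)

theorem translation_eq (hπ : IsPrincipalBundle IG G IM IP π) {p q : P} {g : G}
    (h : p <• g = q) : translation G p q = g :=
  hπ.smul_left_cancel <| by
    rw [hπ.smul_translation (by rw [← h, hπ.proj_smul]), h]

theorem translation_self (hπ : IsPrincipalBundle IG G IM IP π) (p : P) :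
    translation G p p = 1 :=
  hπ.translation_eq (by simp)

theorem translation_smul (hπ : IsPrincipalBundle IG G IM IP π) {p q : P} (h : π p = π q) (g : G) :
    translation G p (q <• g) = translation G p q * g :=
  hπ.translation_eq (by rw [MulOpposite.op_mul, mul_smul, hπ.smul_translation h])

theorem translation_mul_translation (hπ : IsPrincipalBundle IG G IM IP π) {p q r : P}
    (hpq : π p = π q) (hqr : π q = π r) :
    translation G p q * translation G q r = translation G p r := by
  rw [← hπ.translation_smul hpq, hπ.smul_translation hqr]

theorem contMDiffAt_translation [LieGroup IG ∞ G] (hπ : IsPrincipalBundle IG G IM IP π)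
    {f₁ f₂ : N → P} {x : N} (hf₁ : ContMDiffAt IN IP ∞ f₁ x) (hf₂ : ContMDiffAt IN IP ∞ f₂ x)
    (h : ∀ᶠ y in 𝓝 x, π (f₁ y) = π (f₂ y)) :
    ContMDiffAt IN IG ∞ (fun y ↦ translation G (f₁ y) (f₂ y)) x := by
  obtain ⟨φ, hx, hφ⟩ := hπ.exists_chart (π (f₁ x))
  have h₁ := φ.mem_source.2 hx
  have h₂ := φ.mem_source.2 (h.self_of_nhds ▸ hx)
  have smooth₁ := (hφ.smooth.contMDiffAt (φ.open_source.mem_nhds h₁)).comp x hf₁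
  have smooth₂ := (hφ.smooth.contMDiffAt (φ.open_source.mem_nhds h₂)).comp x hf₂
  refine (smooth₁.snd.inv.mul smooth₂.snd).congr_of_eventuallyEq ?_
  filter_upwards [h, hf₁.continuousAt (φ.open_source.mem_nhds h₁)] with y hy hy₁
  have chart_eq := congrArg (fun q ↦ (φ q).2) (hπ.smul_translation hy)
  simp only [hφ.equivariant _ hy₁] at chart_eq
  exact eq_inv_mul_of_mul_eq chart_eq

theorem exists_localSection (hπ : IsPrincipalBundle IG G IM IP π) (x : M) :
    ∃ σ : LocalSection IM IP π, x ∈ σ.dom := by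
  obtain ⟨φ, hx, hφ⟩ := hπ.exists_chart x
  refine ⟨⟨φ.baseSet, φ.open_baseSet, fun y ↦ φ.toOpenPartialHomeomorph.symm (y, 1), ?_, ?_⟩, hx⟩
  · exact hφ.smooth_symm.comp (contMDiff_id.prodMk contMDiff_const).contMDiffOn
      fun y hy ↦ φ.mem_target.2 hy
  · exact fun y hy ↦ φ.proj_symm_apply (φ.mem_target.2 hy)

end IsPrincipalBundle

namespace LocalSection

variable (σ : LocalSection IM IP π)

variable (G) in
/-- The fibre coordinate of the trivialization given by a local section: over `σ.dom`, the point
`p` is `σ (π p) · σ.fibreCoord G p`. -/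
def fibreCoord (p : P) : G := translation G (σ.toFun (π p)) p

variable (G) in
/-- The transition function between local sections: `τ = σ · σ.transition G τ` on
`σ.dom ∩ τ.dom`. -/
def transition (τ : LocalSection IM IP π) (x : M) : G := translation G (σ.toFun x) (τ.toFun x)

theorem contMDiffAt {x : M} (hx : x ∈ σ.dom) : ContMDiffAt IM IP ∞ σ.toFun x :=
  σ.smooth.contMDiffAt (σ.isOpen_dom.mem_nhds hx)

theorem mdifferentiableAt {x : M} (hx : x ∈ σ.dom) : MDifferentiableAt IM IP σ.toFun x :=
  (σ.contMDiffAt hx).mdifferentiableAt (by simp)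

variable {τ : LocalSection IM IP π} (hπ : IsPrincipalBundle IG G IM IP π)
include hπ

theorem smul_fibreCoord {p : P} (hp : π p ∈ σ.dom) : σ.toFun (π p) <• σ.fibreCoord G p = p :=
  hπ.smul_translation (σ.proj _ hp)

theorem fibreCoord_smul {p : P} (hp : π p ∈ σ.dom) (g : G) :
    σ.fibreCoord G (p <• g) = σ.fibreCoord G p * g := by
  rw [fibreCoord, hπ.proj_smul, hπ.translation_smul (σ.proj _ hp), fibreCoord]

theorem fibreCoord_apply {x : M} (hx : x ∈ σ.dom) : σ.fibreCoord G (σ.toFun x) = 1 := by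
  rw [fibreCoord, σ.proj x hx, hπ.translation_self]

theorem smul_transition {x : M} (hσ : x ∈ σ.dom) (hτ : x ∈ τ.dom) :
    σ.toFun x <• σ.transition G τ x = τ.toFun x :=
  hπ.smul_translation ((σ.proj x hσ).trans (τ.proj x hτ).symm)

theorem transition_mul_fibreCoord {p : P} (hσ : π p ∈ σ.dom) (hτ : π p ∈ τ.dom) :
    σ.transition G τ (π p) * τ.fibreCoord G p = σ.fibreCoord G p :=
  hπ.translation_mul_translation ((σ.proj _ hσ).trans (τ.proj _ hτ).symm) (τ.proj _ hτ)

theorem eventually_proj_mem_dom {p : P} (hp : π p ∈ σ.dom) : ∀ᶠ q in 𝓝 p, π q ∈ σ.dom :=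
  hπ.smooth_proj.continuous.continuousAt (σ.isOpen_dom.mem_nhds hp)

variable [LieGroup IG ∞ G]

theorem contMDiffAt_fibreCoord {p : P} (hp : π p ∈ σ.dom) :
    ContMDiffAt IP IG ∞ (σ.fibreCoord G) p :=
  hπ.contMDiffAt_translation ((σ.contMDiffAt hp).comp p hπ.smooth_proj.contMDiffAt) contMDiffAt_id
    ((σ.eventually_proj_mem_dom hπ hp).mono fun _ hq ↦ σ.proj _ hq)

theorem contMDiffAt_transition {x : M} (hσ : x ∈ σ.dom) (hτ : x ∈ τ.dom) :
    ContMDiffAt IM IG ∞ (σ.transition G τ) x := by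
  refine hπ.contMDiffAt_translation (σ.contMDiffAt hσ) (τ.contMDiffAt hτ) ?_
  filter_upwards [σ.isOpen_dom.mem_nhds hσ, τ.isOpen_dom.mem_nhds hτ] with y hyσ hyτ
  exact (σ.proj y hyσ).trans (τ.proj y hyτ).symm

theorem mdifferentiableAt_fibreCoord {p : P} (hp : π p ∈ σ.dom) :
    MDifferentiableAt IP IG (σ.fibreCoord G) p :=
  (σ.contMDiffAt_fibreCoord hπ hp).mdifferentiableAt (by simp)

end LocalSection

end PrincipalBundle

section Gluing

variable {EG : Type*} [NormedAddCommGroup EG] [NormedSpace ℝ EG]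
  {HG : Type*} [TopologicalSpace HG] {IG : ModelWithCorners ℝ EG HG}
  {G : Type*} [TopologicalSpace G] [ChartedSpace HG G] [Group G]
  {EM : Type*} [NormedAddCommGroup EM] [NormedSpace ℝ EM]
  {HM : Type*} [TopologicalSpace HM] {IM : ModelWithCorners ℝ EM HM}
  {M : Type*} [TopologicalSpace M] [ChartedSpace HM M]
  {EP : Type*} [NormedAddCommGroup EP] [NormedSpace ℝ EP]
  {HP : Type*} [TopologicalSpace HP] {IP : ModelWithCorners ℝ EP HP}
  {P : Type*} [TopologicalSpace P] [ChartedSpace HP P] [MulAction Gᵐᵒᵖ P]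
  {EN : Type*} [NormedAddCommGroup EN] [NormedSpace ℝ EN]
  {HN : Type*} [TopologicalSpace HN] {IN : ModelWithCorners ℝ EN HN}
  {N : Type*} [TopologicalSpace N] [ChartedSpace HN N]
  {π : P → M}

namespace LocalSection

/-- The connection form `(π^*β)^c` over `σ.dom` with local connection form `β` along `σ`, where `c`
is the fibre coordinate of `σ`. -/
def connectionForm (σ : LocalSection IM IP π) (β : LieForm IG G IM M) : LieForm IG G IP P :=
  (β.pullback IP π).gauge (σ.fibreCoord G)

variable (σ : LocalSection IM IP π) (β : LieForm IG G IM M)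

theorem connectionForm_congr {β β' : LieForm IG G IM M} {p : P} (h : β (π p) = β' (π p)) :
    σ.connectionForm β p = σ.connectionForm β' p :=
  LieForm.gauge_congr .rfl (LieForm.pullback_congr .rfl h)

variable [LieGroup IG ∞ G]

theorem smoothAt_connectionForm [IsManifold IM ∞ M] [IsManifold IP ∞ P] {β : LieForm IG G IM M}
    (hπ : IsPrincipalBundle IG G IM IP π) {p : P} (hp : π p ∈ σ.dom) (hβ : β.SmoothAt (π p)) :
    (σ.connectionForm β).SmoothAt p :=
  (hβ.pullback hπ.smooth_proj.contMDiffAt).gauge (σ.contMDiffAt_fibreCoord hπ hp)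

theorem pullback_connectionForm (hπ : IsPrincipalBundle IG G IM IP π) {x : M} (hx : x ∈ σ.dom) :
    σ.pullback (σ.connectionForm β) x = β x := by
  have proj_mem : π (σ.toFun x) ∈ σ.dom := by rwa [σ.proj x hx]
  have dom_mem := σ.isOpen_dom.mem_nhds hx
  calc (σ.connectionForm β).pullback IM σ.toFun x
    _ = ((β.pullback IP π).pullback IM σ.toFun).gauge (fun y ↦ σ.fibreCoord G (σ.toFun y)) x :=
      LieForm.pullback_gauge _ (σ.mdifferentiableAt_fibreCoord hπ proj_mem)
        (σ.mdifferentiableAt hx)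
    _ = (β.pullback IM fun y ↦ π (σ.toFun y)).gauge (fun _ ↦ 1) x :=
      LieForm.gauge_congr
        (Filter.mem_of_superset dom_mem fun y hy ↦ σ.fibreCoord_apply hπ hy)
        (β.pullback_comp (hπ.mdifferentiable_proj _) (σ.mdifferentiableAt hx)).symm
    _ = β.pullback IM (fun y ↦ y) x := by
      rw [LieForm.gauge_one]
      exact LieForm.pullback_congr (Filter.mem_of_superset dom_mem σ.proj) rfl
    _ = β x := β.pullback_id x

theorem pullback_smul_connectionForm (hπ : IsPrincipalBundle IG G IM IP π) {f : N → P} {g : N → G}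
    {x : N} (hx : π (f x) ∈ σ.dom) (hf : MDifferentiableAt IN IP f x)
    (hg : MDifferentiableAt IN IG g x) :
    (σ.connectionForm β).pullback IN (fun y ↦ f y <• g y) x =
      ((σ.connectionForm β).pullback IN f).gauge g x := by
  have smul_mdiff : MDifferentiableAt IN IP (fun y ↦ f y <• g y) x :=
    (hπ.mdifferentiable_action (f x, g x)).comp x (hf.prodMk hg)
  have smul_mem : π (f x <• g x) ∈ σ.dom := by rwa [hπ.proj_smul]
  have coord_mdiff := σ.mdifferentiableAt_fibreCoord hπ hx
  have mem_dom : ∀ᶠ y in 𝓝 x, π (f y) ∈ σ.dom :=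
    hf.continuousAt.eventually (σ.eventually_proj_mem_dom hπ hx)
  have base_pullback : (β.pullback IP π).pullback IN (fun y ↦ f y <• g y) x =
      (β.pullback IP π).pullback IN f x := by
    rw [← β.pullback_comp (hπ.mdifferentiable_proj _) smul_mdiff,
      ← β.pullback_comp (hπ.mdifferentiable_proj _) hf]
    simp only [hπ.proj_smul]
  calc (σ.connectionForm β).pullback IN (fun y ↦ f y <• g y) x
    _ = ((β.pullback IP π).pullback IN fun y ↦ f y <• g y).gauge
          (fun y ↦ σ.fibreCoord G (f y <• g y)) x :=
      LieForm.pullback_gauge _ (σ.mdifferentiableAt_fibreCoord hπ smul_mem) smul_mdiff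
    _ = ((β.pullback IP π).pullback IN f).gauge (fun y ↦ σ.fibreCoord G (f y) * g y) x :=
      LieForm.gauge_congr (mem_dom.mono fun y hy ↦ σ.fibreCoord_smul hπ hy (g y)) base_pullback
    _ = (((β.pullback IP π).pullback IN f).gauge fun y ↦ σ.fibreCoord G (f y)).gauge g x :=
      (LieForm.gauge_gauge _ (coord_mdiff.comp x hf) hg).symm
    _ = ((σ.connectionForm β).pullback IN f).gauge g x :=
      LieForm.gauge_congr .rfl (LieForm.pullback_gauge _ coord_mdiff hf).symm

theorem connectionForm_fundamentalField (hπ : IsPrincipalBundle IG G IM IP π) {p : P}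
    (hp : π p ∈ σ.dom) (A : GroupLieAlgebra IG G) :
    σ.connectionForm β p (fundamentalField IG IP A p) = A := by
  have pullback_orbit_one : (σ.connectionForm β).pullback IG (fun g : G ↦ p <• g) 1 =
      ContinuousLinearMap.id ℝ EG := by
    rw [σ.pullback_smul_connectionForm β hπ (f := fun _ ↦ p) (g := fun g ↦ g) hp
      mdifferentiableAt_const mdifferentiableAt_id, LieForm.gauge, LieForm.pullback_const,
      LieForm.pullback_id, maurerCartan_one, ContinuousLinearMap.comp_zero]
    exact add_zero _
  rw [LieForm.apply_fundamentalField, pullback_orbit_one]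
  rfl

theorem connectionForm_equivariant (hπ : IsPrincipalBundle IG G IM IP π) {p : P}
    (hp : π p ∈ σ.dom) (g : G) :
    (σ.connectionForm β).pullback IP (fun q ↦ q <• g) p =
      (ad IG g⁻¹).comp (σ.connectionForm β p) := by
  rw [σ.pullback_smul_connectionForm β hπ (f := fun q ↦ q) (g := fun _ ↦ g) hp
    mdifferentiableAt_id mdifferentiableAt_const, LieForm.gauge_const, LieForm.pullback_id]

theorem connectionForm_gauge_transition (hπ : IsPrincipalBundle IG G IM IP π)
    {τ : LocalSection IM IP π} {p : P} (hσ : π p ∈ σ.dom) (hτ : π p ∈ τ.dom) :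
    τ.connectionForm (β.gauge (σ.transition G τ)) p = σ.connectionForm β p := by
  have proj_mdiff := hπ.mdifferentiable_proj p
  have transition_mdiff : MDifferentiableAt IM IG (σ.transition G τ) (π p) :=
    (σ.contMDiffAt_transition hπ hσ hτ).mdifferentiableAt (by simp)
  calc ((β.gauge (σ.transition G τ)).pullback IP π).gauge (τ.fibreCoord G) p
    _ = ((β.pullback IP π).gauge fun q ↦ σ.transition G τ (π q)).gauge (τ.fibreCoord G) p :=
      LieForm.gauge_congr .rfl (β.pullback_gauge transition_mdiff proj_mdiff)
    _ = (β.pullback IP π).gauge (fun q ↦ σ.transition G τ (π q) * τ.fibreCoord G q) p :=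
      LieForm.gauge_gauge _ (transition_mdiff.comp p proj_mdiff)
        (τ.mdifferentiableAt_fibreCoord hπ hτ)
    _ = σ.connectionForm β p := by
      refine LieForm.gauge_congr ?_ rfl
      filter_upwards [σ.eventually_proj_mem_dom hπ hσ, τ.eventually_proj_mem_dom hπ hτ] with q
      exact σ.transition_mul_fibreCoord hπ

end LocalSection

theorem IsPrincipalConnection.eq_connectionForm [LieGroup IG ∞ G] [IsManifold IP ∞ P]
    (hπ : IsPrincipalBundle IG G IM IP π) {α : LieForm IG G IP P}
    (hα : IsPrincipalConnection IG IP α) (σ : LocalSection IM IP π) {p : P} (hp : π p ∈ σ.dom) :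
    α p = σ.connectionForm (σ.pullback α) p := by
  have section_mdiff := σ.mdifferentiableAt hp
  have proj_mdiff := hπ.mdifferentiable_proj p
  have smul_coord : ∀ᶠ q in 𝓝 p, q = σ.toFun (π q) <• σ.fibreCoord G q :=
    (σ.eventually_proj_mem_dom hπ hp).mono fun q hq ↦ (σ.smul_fibreCoord hπ hq).symm
  calc α p
    _ = α.pullback IP (fun q ↦ q) p := (α.pullback_id p).symm
    _ = α.pullback IP (fun q ↦ σ.toFun (π q) <• σ.fibreCoord G q) p :=
      LieForm.pullback_congr smul_coord rfl
    _ = (α.pullback IP fun q ↦ σ.toFun (π q)).gauge (σ.fibreCoord G) p :=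
      hα.pullback_smul hπ.mdifferentiable_action (section_mdiff.comp p proj_mdiff)
        (σ.mdifferentiableAt_fibreCoord hπ hp)
    _ = ((σ.pullback α).pullback IP π).gauge (σ.fibreCoord G) p :=
      LieForm.gauge_congr .rfl (α.pullback_comp section_mdiff proj_mdiff)

theorem IsPrincipalConnection.isCompatibleFamily [LieGroup IG ∞ G] [IsManifold IM ∞ M]
    [IsManifold IP ∞ P] (hπ : IsPrincipalBundle IG G IM IP π) {α : LieForm IG G IP P}
    (hα : IsPrincipalConnection IG IP α) {ι : Type*} (σ : ι → LocalSection IM IP π) :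
    IsCompatibleFamily IG IM IP σ fun i ↦ (σ i).pullback α where
  smooth i := (LieForm.smoothOn_iff_forall_smoothAt (σ i).isOpen_dom).2 fun x hx ↦
    ((LieForm.smoothOn_iff_forall_smoothAt isOpen_univ).1 hα.smooth _ trivial).pullback
      ((σ i).contMDiffAt hx)
  transition i j g hg hσ x hx := by
    have overlap_mem : (σ i).dom ∩ (σ j).dom ∈ 𝓝 x :=
      ((σ i).isOpen_dom.inter (σ j).isOpen_dom).mem_nhds hx
    have g_mdiff : MDifferentiableAt IM IG g x :=
      (hg.contMDiffAt overlap_mem).mdifferentiableAt (by simp)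
    exact (LieForm.pullback_congr (Filter.mem_of_superset overlap_mem hσ) rfl).trans <|
      hα.pullback_smul hπ.mdifferentiable_action ((σ i).mdifferentiableAt hx.1) g_mdiff

namespace IsCompatibleFamily

variable [LieGroup IG ∞ G] [IsManifold IM ∞ M] {ι : Type*} {σ : ι → LocalSection IM IP π}
  {β : ι → LieForm IG G IM M}

theorem connectionForm_eq (hβ : IsCompatibleFamily IG IM IP σ β)
    (hπ : IsPrincipalBundle IG G IM IP π) {i j : ι} {p : P} (hi : π p ∈ (σ i).dom)
    (hj : π p ∈ (σ j).dom) : (σ i).connectionForm (β i) p = (σ j).connectionForm (β j) p := by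
  have transition_eq : β j (π p) = (β i).gauge ((σ i).transition G (σ j)) (π p) :=
    hβ.transition i j _
      (fun x hx ↦ ((σ i).contMDiffAt_transition hπ hx.1 hx.2).contMDiffWithinAt)
      (fun x hx ↦ ((σ i).smul_transition hπ hx.1 hx.2).symm) (π p) ⟨hi, hj⟩
  rw [(σ j).connectionForm_congr transition_eq, (σ i).connectionForm_gauge_transition _ hπ hi hj]

theorem isPrincipalConnection [IsManifold IP ∞ P] (hβ : IsCompatibleFamily IG IM IP σ β)
    (hπ : IsPrincipalBundle IG G IM IP π) (hcov : ∀ x, ∃ i, x ∈ (σ i).dom)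
    {α : LieForm IG G IP P}
    (hα : ∀ i p, π p ∈ (σ i).dom → α p = (σ i).connectionForm (β i) p) :
    IsPrincipalConnection IG IP α where
  smooth := (LieForm.smoothOn_iff_forall_smoothAt isOpen_univ).2 fun p _ ↦ by
    obtain ⟨i, hi⟩ := hcov (π p)
    have smooth_β := (LieForm.smoothOn_iff_forall_smoothAt (σ i).isOpen_dom).1 (hβ.smooth i) _ hi
    exact ((σ i).smoothAt_connectionForm hπ hi smooth_β).congr
      (((σ i).eventually_proj_mem_dom hπ hi).mono (hα i))
  fundamental A p := by
    obtain ⟨i, hi⟩ := hcov (π p)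
    rw [hα i p hi, (σ i).connectionForm_fundamentalField (β i) hπ hi]
  equivariant g p := by
    obtain ⟨i, hi⟩ := hcov (π p)
    rw [hα i p hi, hα i (p <• g) (by rwa [hπ.proj_smul])]
    exact (σ i).connectionForm_equivariant (β i) hπ hi g

theorem existsUnique_isPrincipalConnection [IsManifold IP ∞ P]
    (hβ : IsCompatibleFamily IG IM IP σ β) (hπ : IsPrincipalBundle IG G IM IP π)
    (hcov : ∀ x, ∃ i, x ∈ (σ i).dom) :
    ∃! α : LieForm IG G IP P, IsPrincipalConnection IG IP α ∧
      ∀ i, ∀ x ∈ (σ i).dom, β i x = (σ i).pullback α x := by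
  choose k hk using hcov
  let α : LieForm IG G IP P := fun p ↦ (σ (k (π p))).connectionForm (β (k (π p))) p
  have α_eq (i p) (hp : π p ∈ (σ i).dom) : α p = (σ i).connectionForm (β i) p :=
    hβ.connectionForm_eq hπ (hk _) hp
  refine ⟨α, ⟨hβ.isPrincipalConnection hπ (fun x ↦ ⟨k x, hk x⟩) α_eq, fun i x hx ↦ ?_⟩,
    fun α' ⟨hα', pullback_eq⟩ ↦ funext fun p ↦ ?_⟩
  · rw [← (σ i).pullback_connectionForm (β i) hπ hx]
    have section_mem : π ((σ i).toFun x) ∈ (σ i).dom := by rwa [(σ i).proj x hx]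
    exact LieForm.pullback_congr .rfl (α_eq i _ section_mem).symm
  · rw [hα'.eq_connectionForm hπ (σ (k (π p))) (hk _)]
    exact (σ (k (π p))).connectionForm_congr (pullback_eq _ _ (hk _)).symm

end IsCompatibleFamily

end Gluing

end PrincipalConn

end

open PrincipalConn in
theorem mainTheorem6_general
    {EG : Type*} [NormedAddCommGroup EG] [NormedSpace ℝ EG]
    {HG : Type*} [TopologicalSpace HG] (IG : ModelWithCorners ℝ EG HG)
    {G : Type*} [TopologicalSpace G] [ChartedSpace HG G] [Group G] [LieGroup IG ∞ G]
    {EM : Type*} [NormedAddCommGroup EM] [NormedSpace ℝ EM]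
    {HM : Type*} [TopologicalSpace HM] (IM : ModelWithCorners ℝ EM HM)
    {M : Type*} [TopologicalSpace M] [ChartedSpace HM M] [IsManifold IM ∞ M]
    {EP : Type*} [NormedAddCommGroup EP] [NormedSpace ℝ EP]
    {HP : Type*} [TopologicalSpace HP] (IP : ModelWithCorners ℝ EP HP)
    {P : Type*} [TopologicalSpace P] [ChartedSpace HP P] [IsManifold IP ∞ P]
    [MulAction Gᵐᵒᵖ P] (π : P → M) (hπ : IsPrincipalBundle IG G IM IP π) :
    (∀ β : LocalSection IM IP π → LieForm IG G IM M, IsLocalConnection IG IM IP β →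
      ∃! α : LieForm IG G IP P, IsPrincipalConnection IG IP α ∧
        ∀ σ : LocalSection IM IP π, ∀ x ∈ σ.dom, β σ x = σ.pullback α x) ∧
    (∀ α : LieForm IG G IP P, IsPrincipalConnection IG IP α →
      IsLocalConnection IG IM IP (fun σ : LocalSection IM IP π ↦ σ.pullback α)) ∧
    (∀ (ι : Type*) (σ : ι → LocalSection IM IP π) (β : ι → LieForm IG G IM M),
      (∀ x : M, ∃ i, x ∈ (σ i).dom) → IsCompatibleFamily IG IM IP σ β →
      ∃! α : LieForm IG G IP P, IsPrincipalConnection IG IP α ∧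
        ∀ i, ∀ x ∈ (σ i).dom, β i x = (σ i).pullback α x) :=
  ⟨fun _ hβ ↦ IsCompatibleFamily.existsUnique_isPrincipalConnection hβ hπ hπ.exists_localSection,
    fun _ hα ↦ hα.isCompatibleFamily hπ _,
    fun _ _ _ hcov hβ ↦ hβ.existsUnique_isPrincipalConnection hπ hcov⟩

open PrincipalConn in
theorem mainTheorem6
    {EG : Type*} [NormedAddCommGroup EG] [NormedSpace ℝ EG] [FiniteDimensional ℝ EG]
    {HG : Type*} [TopologicalSpace HG] (IG : ModelWithCorners ℝ EG HG) [IG.Boundaryless]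
    {G : Type*} [TopologicalSpace G] [ChartedSpace HG G] [Group G] [LieGroup IG ∞ G]
    {EM : Type*} [NormedAddCommGroup EM] [NormedSpace ℝ EM] [FiniteDimensional ℝ EM]
    {HM : Type*} [TopologicalSpace HM] (IM : ModelWithCorners ℝ EM HM) [IM.Boundaryless]
    {M : Type*} [TopologicalSpace M] [ChartedSpace HM M] [IsManifold IM ∞ M]
    {EP : Type*} [NormedAddCommGroup EP] [NormedSpace ℝ EP] [FiniteDimensional ℝ EP]
    {HP : Type*} [TopologicalSpace HP] (IP : ModelWithCorners ℝ EP HP) [IP.Boundaryless]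
    {P : Type*} [TopologicalSpace P] [ChartedSpace HP P] [IsManifold IP ∞ P]
    [MulAction Gᵐᵒᵖ P] (π : P → M) (hπ : IsPrincipalBundle IG G IM IP π) :
    -- a local connection glues to a unique principal connection form
    (∀ β : LocalSection IM IP π → LieForm IG G IM M, IsLocalConnection IG IM IP β →
      ∃! α : LieForm IG G IP P, IsPrincipalConnection IG IP α ∧
        ∀ σ : LocalSection IM IP π, ∀ x ∈ σ.dom, β σ x = σ.pullback α x) ∧
    -- conversely, the pullbacks of a principal connection form are a local connection
    (∀ α : LieForm IG G IP P, IsPrincipalConnection IG IP α →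
      IsLocalConnection IG IM IP (fun σ : LocalSection IM IP π ↦ σ.pullback α)) ∧
    -- for the gluing, local sections whose domains cover `M` suffice
    (∀ (ι : Type*) (σ : ι → LocalSection IM IP π) (β : ι → LieForm IG G IM M),
      (∀ x : M, ∃ i, x ∈ (σ i).dom) → IsCompatibleFamily IG IM IP σ β →
      ∃! α : LieForm IG G IP P, IsPrincipalConnection IG IP α ∧
        ∀ i, ∀ x ∈ (σ i).dom, β i x = (σ i).pullback α x) := by
  exact mainTheorem6_general IG IM IP π hπ
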